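/- For $n\ge 1$ let $V_n=\{0,1\}^n$, and let the $n$-cube $Q_n$ be the graph on $V_n$ in which two vectors are adjacent if and only if they differ in exactly one coordinate. The hierarchical cubic network $HCN_n$ is the simple graph with vertex set $V_n\times V_n$ consisting of the $2^n$ $n$-cubes $\{x\}\times Q_n$ ($x\in V_n$) together with crossing edges that join each vertex $(x,y)$ to $(y,x)$ if $x\ne y$, and to $(\bar x,\bar y)$ if $x=y$, where $\bar x$ denotes the bitwise complement of $x$. For a finite graph $G$ and an integer $h\ge 0$, an $h$-vertex-cut (respectively $h$-edge-cut) of $G$ is a set $S\subseteq V(G)$ (respectively $F\subseteq E(G)$) such that $G-S$ (respectively $G-F$) is disconnected and has minimum degree at least $h$. The $h$-super connectivity $\kappa^h(G)$ (respectively $h$-super edge-connectivity $\lambda^h(G)$) is the minimum cardinality of an $h$-vertex-cut (respectively $h$-edge-cut) of $G$. **Theorem.** Let $n\ge 1$. Then $HCN_n$ has $h$-vertex-cuts for every integer $h$ with $0\le h\le n-1$, and $$\kappa^h(HCN_n)=2^h(n+1-h)\qquad\text{for every } h \text{ with } 0\le h\le n-1;$$ and $HCN_n$ has $h$-edge-cuts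 for every integer $h$ with $0\le h\le n$, and $$\lambda^h(HCN_n)=2^h(n+1-h)\qquad\text{for every } h \text{ with } 0\le h\le n.$$ -/

import Mathlib

namespace SimpleGraph

/-- The `n`-cube `Q_n`: binary vectors of length `n`, adjacent iff they differ in exactly one
coordinate. -/
def binaryCube (n : ℕ) : SimpleGraph (Fin n → Bool) where
  Adj x y := hammingDist x y = 1
  symm := ⟨fun x y h => by rw [hammingDist_comm]; exact h⟩
  loopless := ⟨fun x h => by simp [hammingDist_self] at h⟩

/-- The bitwise complement of a binary vector. -/
def bitCompl {n : ℕ} (x : Fin n → Bool) : Fin n → Bool := fun i => !(x i)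

/-- The external neighbor of the vertex `(x, y)`: it is `(y, x)` if `x ≠ y`, and it is the pair of
bitwise complements of `x` and `y` if `x = y`. -/
def externalNeighbor {n : ℕ} (p : (Fin n → Bool) × (Fin n → Bool)) :
    (Fin n → Bool) × (Fin n → Bool) :=
  if p.1 = p.2 then (bitCompl p.1, bitCompl p.2) else (p.2, p.1)

theorem bitCompl_bitCompl {n : ℕ} (x : Fin n → Bool) : bitCompl (bitCompl x) = x := by
  funext i
  simp [bitCompl]

theorem externalNeighbor_externalNeighbor {n : ℕ} (p : (Fin n → Bool) × (Fin n → Bool)) :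
    externalNeighbor (externalNeighbor p) = p := by
  obtain ⟨x, y⟩ := p
  by_cases h : x = y
  · subst h
    simp [externalNeighbor, bitCompl_bitCompl]
  · have h2 : ¬ y = x := fun e => h e.symm
    simp [externalNeighbor, h, h2]

/-- The hierarchical cubic network `HCN_n`: the disjoint `n`-cubes `{x} × Q_n`, together with the
crossing edges joining each vertex to its external neighbor. (The requirement `p ≠ q` only matters
for `n = 0`, where a vertex would be its own external neighbor.) -/
def hierarchicalCubicNetwork (n : ℕ) : SimpleGraph ((Fin n → Bool) × (Fin n → Bool)) where
  Adj p q := (p.1 = q.1 ∧ (binaryCube n).Adj p.2 q.2) ∨ (p ≠ q ∧ q = externalNeighbor p)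
  symm := ⟨by
    rintro p q (⟨h1, h2⟩ | ⟨h1, h2⟩)
    · exact Or.inl ⟨h1.symm, h2.symm⟩
    · refine Or.inr ⟨h1.symm, ?_⟩
      rw [h2, externalNeighbor_externalNeighbor]⟩
  loopless := ⟨by
    rintro p (⟨_, h2⟩ | ⟨h1, _⟩)
    · exact (binaryCube n).irrefl h2
    · exact h1 rfl⟩

open Classical in
/-- `S` is an `h`-vertex-cut of `G`: the graph `G - S` is disconnected and has minimum degree at
least `h`. (Disconnected means that two remaining vertices are not joined by a walk; in particular
`G - S` has at least two vertices.) -/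
def IsSuperVertexCut {V : Type*} [Fintype V] (G : SimpleGraph V) (h : ℕ) (S : Finset V) : Prop :=
  ¬ (G.induce {v | v ∉ S}).Preconnected ∧ h ≤ (G.induce {v | v ∉ S}).minDegree

open Classical in
/-- `F` is an `h`-edge-cut of `G`: a set of edges of `G` such that `G - F` is disconnected and has
minimum degree at least `h`. -/
def IsSuperEdgeCut {V : Type*} [Fintype V] (G : SimpleGraph V) (h : ℕ) (F : Finset (Sym2 V)) :
    Prop :=
  (F : Set (Sym2 V)) ⊆ G.edgeSet ∧ ¬ (G.deleteEdges (F : Set (Sym2 V))).Preconnected ∧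
    h ≤ (G.deleteEdges (F : Set (Sym2 V))).minDegree

/-- The `h`-super connectivity: the minimum cardinality of an `h`-vertex-cut
(and `⊤` if there is none). -/
noncomputable def superConnectivity {V : Type*} [Fintype V] (G : SimpleGraph V) (h : ℕ) : ℕ∞ :=
  ⨅ S : {S : Finset V // G.IsSuperVertexCut h S}, (S.1.card : ℕ∞)

/-- The `h`-super edge-connectivity: the minimum cardinality of an `h`-edge-cut
(and `⊤` if there is none). -/
noncomputable def superEdgeConnectivity {V : Type*} [Fintype V] (G : SimpleGraph V) (h : ℕ) : ℕ∞ :=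
  ⨅ F : {F : Finset (Sym2 V) // G.IsSuperEdgeCut h F}, (F.1.card : ℕ∞)

end SimpleGraph

/-!
# Super connectivity of the hierarchical cubic network

Vertex cuts and edge cuts are treated together. Deleting an `h`-vertex-cut or an `h`-edge-cut leaves
two disjoint nonempty sets `A` and `B` of vertices, each inducing a subgraph of minimum degree at
least `h`: a connected component of what remains, and the union of the other ones. The size of the
cut is at least `cutCost A B`, the number of vertices outside `A ∪ B` plus the number of edges
between `A` and `B`. So both lower bounds follow from `le_cutCost_network`, an estimate of `cutCost`.

On the cube, everything is an induction on the dimension which splits the cube into two halves; the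
minimum degree of the part of `A` in a half drops by at most one, and does not drop if `A` lies in
this half. This gives `2 ^ h * (n + 1 - h) ≤ #A + #(outerBoundary A)`
(`le_card_add_card_outerBoundary`) and `2 ^ k * (n - k) ≤ cutCost A B` (`le_cutCost_cube`): if both
halves meet both `A` and `B`, the bounds for the two halves add up, and if `A`, say, lies in one
half, its boundary in this half and its mirror image in the other half already are large enough.

In the network, consider which of the `2 ^ n` cubes meet `A` and which meet `B`.
* If a cube meets neither, its `2 ^ n` vertices are deleted, and this suffices.
* If `A` lies in a single cube, its boundary in this cube together with the external neighbours of
  its vertices suffices, by the bound for the closed neighbourhood in the cube.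
* A cube meeting both contributes half of the bound, by `le_cutCost_cube` with `k = h - 1`. So two
  such cubes suffice. If there is at most one, the edges between the cubes which only meet `A` and
  those which only meet `B` contribute what is missing.

The bound is attained by a subcube of dimension `h` of one of the cubes: the edges leaving it form an
edge cut, and the vertices adjacent to it form a vertex cut if `h < n`.
-/

namespace SimpleGraph

open Finset

/-! ### The cost of separating two vertex sets -/

section Cut

variable {V : Type*} [Fintype V] [DecidableEq V] (G : SimpleGraph V) [DecidableRel G.Adj]

/-- Every vertex of `A` has at least `h` neighbours in `A`: the subgraph of `G` induced on `A` has
minimum degree at least `h`, or `A` is empty. -/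
def HasInnerDegree (h : ℕ) (A : Finset V) : Prop :=
  ∀ v ∈ A, h ≤ #{u ∈ A | G.Adj v u}

/-- The vertices outside `A` with a neighbour in `A`. -/
def outerBoundary (A : Finset V) : Finset V :=
  {v | v ∉ A ∧ ∃ u ∈ A, G.Adj u v}

/-- The number of vertices and edges which have to be deleted to separate `A` from `B` without
deleting a vertex of `A` or `B`, for disjoint `A` and `B`: all the vertices outside `A ∪ B` and all
the edges between `A` and `B` are counted. -/
def cutCost (A B : Finset V) : ℕ :=
  #(A ∪ B)ᶜ + #(G.interedges A B)

/-- The contribution of the vertex `v` to `cutCost`; an edge between `A` and `B` is charged to its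
end in `B`. -/
def cutWeight (A B : Finset V) (v : V) : ℕ :=
  (if v ∈ A ∨ v ∈ B then 0 else 1) + if v ∈ B then #{u ∈ A | G.Adj u v} else 0

variable {G}

theorem mem_outerBoundary {A : Finset V} {v : V} :
    v ∈ G.outerBoundary A ↔ v ∉ A ∧ ∃ u ∈ A, G.Adj u v := by
  simp [outerBoundary]

theorem cutCost_comm (A B : Finset V) : G.cutCost A B = G.cutCost B A := by
  have := G.symm
  unfold cutCost
  rw [union_comm, interedges, interedges, Rel.card_interedges_comm]

theorem cutCost_eq_sum (A B : Finset V) : G.cutCost A B = ∑ v, G.cutWeight A B v := by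
  unfold cutCost cutWeight
  rw [sum_add_distrib]
  congr 1
  · rw [card_eq_sum_ones, ← sum_filter_add_sum_filter_not univ (fun v => v ∈ A ∨ v ∈ B)]
    rw [sum_ite_of_true (by simp), sum_ite_of_false (by simp)]
    simp only [sum_const_zero, zero_add]
    congr 1
    ext v
    simp
  · rw [interedges, Rel.interedges, card_filter, sum_product_right]
    simp

theorem one_le_cutWeight {A B : Finset V} {v : V} (hv : v ∈ G.outerBoundary A) :
    1 ≤ G.cutWeight A B v := by
  obtain ⟨hvA, u, hu, huv⟩ := mem_outerBoundary.1 hv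
  unfold cutWeight
  by_cases hB : v ∈ B
  · have : 0 < #{u ∈ A | G.Adj u v} := card_pos.2 ⟨u, by simp [hu, huv]⟩
    simp only [hB, if_true]
    omega
  · simp [hvA, hB]

/-- Each vertex of the boundary of `A` is outside `A ∪ B`, or is in `B` and joined to `A`. -/
theorem card_outerBoundary_le_cutCost (A B : Finset V) :
    #(G.outerBoundary A) ≤ G.cutCost A B := by
  rw [cutCost_eq_sum, card_eq_sum_ones]
  calc ∑ v ∈ G.outerBoundary A, 1 ≤ ∑ v ∈ G.outerBoundary A, G.cutWeight A B v :=
        sum_le_sum fun v hv => one_le_cutWeight hv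
    _ ≤ _ := sum_le_sum_of_subset (subset_univ _)

end Cut

/-! ### The cube -/

section Cube

variable {n : ℕ}

instance : DecidableRel (binaryCube n).Adj := fun x y =>
  inferInstanceAs (Decidable (hammingDist x y = 1))

theorem binaryCube_adj_cons (b c : Bool) (y z : Fin n → Bool) :
    (binaryCube (n + 1)).Adj (Fin.cons b y) (Fin.cons c z) ↔
      (b = c ∧ (binaryCube n).Adj y z) ∨ (b ≠ c ∧ y = z) := by
  have key : hammingDist (Fin.cons b y : Fin (n + 1) → Bool) (Fin.cons c z) =
      (if b ≠ c then 1 else 0) + hammingDist y z := by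
    simp only [hammingDist, card_filter, Fin.sum_univ_succ, Fin.cons_zero, Fin.cons_succ]
  change hammingDist _ _ = 1 ↔ (_ ∧ hammingDist y z = 1) ∨ _
  rw [key]
  by_cases h : b = c
  · simp [h]
  · simp [h, hammingDist_eq_zero]

theorem sum_cube_succ (f : (Fin (n + 1) → Bool) → ℕ) (b : Bool) :
    ∑ v, f v = ∑ y : Fin n → Bool, f (Fin.cons b y) + ∑ y : Fin n → Bool, f (Fin.cons (!b) y) := by
  rw [← (Fin.consEquiv (fun _ : Fin (n + 1) => Bool)).sum_comp, Fintype.sum_prod_type]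
  cases b <;> simp [Fin.consEquiv, add_comm]

/-- The part of `A` in the half of the cube on which the first coordinate is `b`, as a set of
vertices of the cube of one dimension less. -/
def slice (b : Bool) (A : Finset (Fin (n + 1) → Bool)) : Finset (Fin n → Bool) :=
  {y | (Fin.cons b y : Fin (n + 1) → Bool) ∈ A}

@[simp]
theorem mem_slice {b : Bool} {A : Finset (Fin (n + 1) → Bool)} {y : Fin n → Bool} :
    y ∈ slice b A ↔ (Fin.cons b y : Fin (n + 1) → Bool) ∈ A := by
  simp [slice]

theorem card_eq_card_slice (b : Bool) (A : Finset (Fin (n + 1) → Bool)) :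
    #A = #(slice b A) + #(slice (!b) A) := by
  have h := sum_cube_succ (fun v => if v ∈ A then 1 else 0) b
  rw [← card_filter, ← card_filter, ← card_filter] at h
  simpa [slice] using h

theorem slice_nonempty_or {A : Finset (Fin (n + 1) → Bool)} (hA : A.Nonempty) (b : Bool) :
    (slice b A).Nonempty ∨ (slice (!b) A).Nonempty := by
  have h := card_eq_card_slice b A
  have := hA.card_pos
  rw [← card_pos, ← card_pos]
  omega

theorem disjoint_slice {A B : Finset (Fin (n + 1) → Bool)} (h : Disjoint A B) (b : Bool) :
    Disjoint (slice b A) (slice b B) := by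
  rw [Finset.disjoint_left] at h ⊢
  intro y hy
  simpa using h (mem_slice.1 hy)

theorem card_inner_neighbors_cons (A : Finset (Fin (n + 1) → Bool)) (b : Bool) (y : Fin n → Bool) :
    #{u ∈ A | (binaryCube (n + 1)).Adj (Fin.cons b y) u} =
      #{z ∈ slice b A | (binaryCube n).Adj y z} + if y ∈ slice (!b) A then 1 else 0 := by
  rw [card_eq_card_slice b]
  congr 1
  · congr 1
    ext z
    simp [binaryCube_adj_cons]
  · have : slice (!b) {u ∈ A | (binaryCube (n + 1)).Adj (Fin.cons b y) u} =
        if y ∈ slice (!b) A then {y} else ∅ := by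
      ext z
      split_ifs with h
      · simp only [mem_slice, mem_filter, binaryCube_adj_cons, mem_singleton]
        constructor
        · rintro ⟨-, h | h⟩
          · simp at h
          · exact h.2.symm
        · rintro rfl
          exact ⟨mem_slice.1 h, by simp⟩
      · simp only [mem_slice, mem_filter, binaryCube_adj_cons, notMem_empty, iff_false]
        rintro ⟨hz, h' | h'⟩
        · simp at h'
        · exact h (mem_slice.2 (h'.2 ▸ hz))
    rw [this]
    split_ifs <;> simp

theorem HasInnerDegree.slice {h : ℕ} {A : Finset (Fin (n + 1) → Bool)}
    (hA : (binaryCube (n + 1)).HasInnerDegree h A) (b : Bool) :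
    (binaryCube n).HasInnerDegree (h - 1) (slice b A) := by
  intro y hy
  have := hA _ (mem_slice.1 hy)
  rw [card_inner_neighbors_cons] at this
  split_ifs at this <;> omega

theorem HasInnerDegree.slice_of_eq_empty {h : ℕ} {A : Finset (Fin (n + 1) → Bool)}
    (hA : (binaryCube (n + 1)).HasInnerDegree h A) {b : Bool} (hb : SimpleGraph.slice (!b) A = ∅) :
    (binaryCube n).HasInnerDegree h (SimpleGraph.slice b A) := by
  intro y hy
  have := hA _ (mem_slice.1 hy)
  rwa [card_inner_neighbors_cons, hb, if_neg (notMem_empty y)] at this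

theorem outerBoundary_slice_subset (A : Finset (Fin (n + 1) → Bool)) (b : Bool) :
    (binaryCube n).outerBoundary (slice b A) ⊆ slice b ((binaryCube (n + 1)).outerBoundary A) := by
  intro y hy
  obtain ⟨h1, u, hu, huy⟩ := mem_outerBoundary.1 hy
  rw [mem_slice, mem_outerBoundary]
  exact ⟨by simpa using h1, _, mem_slice.1 hu, by simp [binaryCube_adj_cons, huy]⟩

/-- If `A` lies in one half of the cube, then its boundary consists of its boundary in this half
and of its mirror image in the other half. -/
theorem card_le_card_outerBoundary {A : Finset (Fin (n + 1) → Bool)} {b : Bool}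
    (hb : slice (!b) A = ∅) :
    #(slice b A) + #((binaryCube n).outerBoundary (slice b A)) ≤
      #((binaryCube (n + 1)).outerBoundary A) := by
  rw [card_eq_card_slice b ((binaryCube (n + 1)).outerBoundary A), add_comm]
  refine add_le_add (card_le_card (outerBoundary_slice_subset A b)) (card_le_card ?_)
  intro y hy
  rw [mem_slice, mem_outerBoundary]
  refine ⟨fun h => ?_, _, mem_slice.1 hy, by simp [binaryCube_adj_cons]⟩
  have := mem_slice.2 h
  simp [hb] at this

theorem slice_cases {A : Finset (Fin (n + 1) → Bool)} (hA : A.Nonempty) :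
    (∀ b, (slice b A).Nonempty) ∨ ∃ b, (slice b A).Nonempty ∧ slice (!b) A = ∅ := by
  by_cases h : ∀ b, (slice b A).Nonempty
  · exact Or.inl h
  · push Not at h
    obtain ⟨b, hb⟩ := h
    refine Or.inr ⟨!b, ?_, by simpa using hb⟩
    rcases slice_nonempty_or hA b with h | h
    · simp [hb] at h
    · exact h

theorem two_pow_le_card : ∀ {n h : ℕ} {A : Finset (Fin n → Bool)}, A.Nonempty →
    (binaryCube n).HasInnerDegree h A → 2 ^ h ≤ #A
  | 0, h, A, hA, hd => by
    obtain ⟨v, hv⟩ := hA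
    have h0 := hd v hv
    have : #{u ∈ A | (binaryCube 0).Adj v u} = 0 := by
      rw [card_eq_zero, filter_eq_empty_iff]
      intro u _ huv
      exact huv.ne (Subsingleton.elim _ _)
    obtain rfl : h = 0 := by omega
    simpa using card_pos.2 ⟨v, hv⟩
  | n + 1, h, A, hA, hd => by
    rcases slice_cases hA with hb | ⟨b, hb, hb'⟩
    · rw [card_eq_card_slice true]
      have h1 := two_pow_le_card (hb true) (hd.slice true)
      have h2 := two_pow_le_card (hb (!true)) (hd.slice (!true))
      rcases h with _ | h
      · simp only [zero_tsub, pow_zero] at h1 h2 ⊢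
        omega
      · rw [add_tsub_cancel_right] at h1 h2
        rw [pow_succ]; omega
    · have := two_pow_le_card hb (hd.slice_of_eq_empty hb')
      rw [card_eq_card_slice b]
      omega

/-- The isoperimetric inequality for vertex sets of the cube which induce a subgraph of minimum
degree at least `h`: subcubes of dimension `h` have the smallest closed neighbourhood. -/
theorem le_card_add_card_outerBoundary : ∀ {n h : ℕ} {A : Finset (Fin n → Bool)}, A.Nonempty →
    (binaryCube n).HasInnerDegree h A →
    2 ^ h * (n + 1 - h) ≤ #A + #((binaryCube n).outerBoundary A)
  | 0, h, A, hA, hd => by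
    have := two_pow_le_card hA hd
    calc 2 ^ h * (0 + 1 - h) ≤ 2 ^ h * 1 := Nat.mul_le_mul_left _ (by omega)
      _ ≤ _ := by omega
  | n + 1, h, A, hA, hd => by
    rcases slice_cases hA with hb | ⟨b, hb, hb'⟩
    · have h1 := le_card_add_card_outerBoundary (hb true) (hd.slice true)
      have h2 := le_card_add_card_outerBoundary (hb (!true)) (hd.slice (!true))
      have h3 := card_eq_card_slice true A
      have h4 := card_eq_card_slice true ((binaryCube (n + 1)).outerBoundary A)
      have h5 := card_le_card (outerBoundary_slice_subset A true)
      have h6 := card_le_card (outerBoundary_slice_subset A (!true))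
      rcases h with _ | h
      · simp only [zero_tsub, pow_zero, one_mul] at h1 h2 ⊢
        omega
      · rw [add_tsub_cancel_right] at h1 h2
        have : 2 ^ (h + 1) * (n + 1 + 1 - (h + 1)) = 2 * (2 ^ h * (n + 1 - h)) := by
          rw [pow_succ, Nat.add_sub_add_right]; ring
        omega
    · have h1 := le_card_add_card_outerBoundary hb (hd.slice_of_eq_empty hb')
      have h2 := card_le_card_outerBoundary hb'
      have h3 := card_eq_card_slice b A
      have h4 := two_pow_le_card hb (hd.slice_of_eq_empty hb')
      calc 2 ^ h * (n + 1 + 1 - h) ≤ 2 ^ h * ((n + 1 - h) + 1) :=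
            Nat.mul_le_mul_left _ (by omega)
        _ = 2 ^ h * (n + 1 - h) + 2 ^ h := by ring
        _ ≤ _ := by omega

theorem cutCost_slice_le (A B : Finset (Fin (n + 1) → Bool)) :
    (binaryCube n).cutCost (slice true A) (slice true B) +
      (binaryCube n).cutCost (slice false A) (slice false B) ≤ (binaryCube (n + 1)).cutCost A B := by
  have key : ∀ b y, (binaryCube n).cutWeight (slice b A) (slice b B) y ≤
      (binaryCube (n + 1)).cutWeight A B (Fin.cons b y) := by
    intro b y
    simp only [cutWeight, mem_slice]
    gcongr
    split_ifs
    · simp only [adj_comm _ _ y, adj_comm _ _ (Fin.cons b y : Fin (n + 1) → Bool),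
        card_inner_neighbors_cons]
      omega
    · rfl
  rw [cutCost_eq_sum, cutCost_eq_sum, cutCost_eq_sum, sum_cube_succ _ true]
  exact add_le_add (sum_le_sum fun y _ => key _ y) (sum_le_sum fun y _ => key _ y)

/-- Both super connectivities of the cube at once: separating `A` from `B` in the `n`-cube by
deleting vertices and edges costs at least `2 ^ k * (n - k)`. -/
theorem le_cutCost_cube : ∀ {n k : ℕ} {A B : Finset (Fin n → Bool)}, Disjoint A B →
    A.Nonempty → B.Nonempty → (binaryCube n).HasInnerDegree k A →
    (binaryCube n).HasInnerDegree k B → 2 ^ k * (n - k) ≤ (binaryCube n).cutCost A B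
  | 0, k, A, B, _, _, _, _, _ => by simp
  | n + 1, k, A, B, hAB, hA, hB, hdA, hdB => by
    -- If `A` lies in one half, then the boundary of `A` is already large enough.
    have one_half : ∀ {A B : Finset (Fin (n + 1) → Bool)} (b : Bool),
        (binaryCube (n + 1)).HasInnerDegree k A → (slice b A).Nonempty → slice (!b) A = ∅ →
        2 ^ k * (n + 1 - k) ≤ (binaryCube (n + 1)).cutCost A B := fun {A B} b hd hb hb' =>
      (le_card_add_card_outerBoundary hb (hd.slice_of_eq_empty hb')).trans <|
        (card_le_card_outerBoundary hb').trans (card_outerBoundary_le_cutCost A B)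
    rcases slice_cases hA with ha | ⟨b, hb, hb'⟩
    swap
    · exact one_half b hdA hb hb'
    rcases slice_cases hB with hb | ⟨b, hb, hb'⟩
    swap
    · rw [cutCost_comm]
      exact one_half b hdB hb hb'
    have h1 := le_cutCost_cube (disjoint_slice hAB true) (ha _) (hb _) (hdA.slice true)
      (hdB.slice true)
    have h2 := le_cutCost_cube (disjoint_slice hAB false) (ha _) (hb _) (hdA.slice false)
      (hdB.slice false)
    have h3 := cutCost_slice_le A B
    rcases k with _ | k
    · -- The halves have more than one vertex, as each of them meets both `A` and `B`.
      have hn : n ≠ 0 := by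
        rintro rfl
        obtain ⟨y, hy⟩ := ha true
        obtain ⟨z, hz⟩ := hb true
        exact Finset.disjoint_left.1 (disjoint_slice hAB true) hy (Subsingleton.elim z y ▸ hz)
      simp only [zero_tsub, pow_zero, one_mul] at h1 h2 ⊢
      omega
    · rw [add_tsub_cancel_right] at h1 h2
      have : 2 ^ (k + 1) * (n + 1 - (k + 1)) = 2 * (2 ^ k * (n - k)) := by
        rw [pow_succ, Nat.add_sub_add_right]; ring
      omega

end Cube

/-! ### Lower bound for the network -/

section Network

variable {n : ℕ}

instance : DecidableRel (hierarchicalCubicNetwork n).Adj := fun p q =>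
  inferInstanceAs (Decidable ((p.1 = q.1 ∧ (binaryCube n).Adj p.2 q.2) ∨
    (p ≠ q ∧ q = externalNeighbor p)))

theorem bitCompl_ne (hn : 1 ≤ n) (x : Fin n → Bool) : bitCompl x ≠ x := fun h => by
  simpa [bitCompl] using congrFun h ⟨0, hn⟩

theorem externalNeighbor_of_ne {x y : Fin n → Bool} (h : x ≠ y) :
    externalNeighbor (x, y) = (y, x) := by
  simp [externalNeighbor, h]

theorem externalNeighbor_injective :
    Function.Injective (externalNeighbor : (Fin n → Bool) × (Fin n → Bool) → _) :=
  Function.Involutive.injective externalNeighbor_externalNeighbor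

theorem externalNeighbor_fst_ne (hn : 1 ≤ n) (p : (Fin n → Bool) × (Fin n → Bool)) :
    (externalNeighbor p).1 ≠ p.1 := by
  unfold externalNeighbor
  split_ifs with h
  · exact bitCompl_ne hn _
  · exact fun h' => h h'.symm

theorem network_adj_iff (hn : 1 ≤ n) {p q : (Fin n → Bool) × (Fin n → Bool)} :
    (hierarchicalCubicNetwork n).Adj p q ↔
      (p.1 = q.1 ∧ (binaryCube n).Adj p.2 q.2) ∨ q = externalNeighbor p := by
  refine or_congr_right ⟨fun h => h.2, fun h => ⟨?_, h⟩⟩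
  rintro rfl
  exact externalNeighbor_fst_ne hn p (congrArg Prod.fst h).symm

/-- The part of `A` in the cube `{x} × Q_n`, as a set of vertices of `Q_n`. -/
def row (x : Fin n → Bool) (A : Finset ((Fin n → Bool) × (Fin n → Bool))) :
    Finset (Fin n → Bool) :=
  {y | (x, y) ∈ A}

@[simp]
theorem mem_row {x y : Fin n → Bool} {A : Finset ((Fin n → Bool) × (Fin n → Bool))} :
    y ∈ row x A ↔ (x, y) ∈ A := by
  simp [row]

theorem card_network_neighbors (hn : 1 ≤ n) (A : Finset ((Fin n → Bool) × (Fin n → Bool)))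
    (x y : Fin n → Bool) :
    #{u ∈ A | (hierarchicalCubicNetwork n).Adj (x, y) u} =
      #{z ∈ row x A | (binaryCube n).Adj y z} + if externalNeighbor (x, y) ∈ A then 1 else 0 := by
  rw [← card_filter_add_card_filter_not (fun u => u.1 = x)]
  congr 1
  · rw [← card_image_of_injective {z ∈ row x A | (binaryCube n).Adj y z}
      (Prod.mk_right_injective x)]
    congr 1
    ext ⟨a, b⟩
    simp only [mem_filter, network_adj_iff hn, mem_image, mem_row, Prod.mk.injEq]
    constructor
    · rintro ⟨⟨h1, h2 | h2⟩, h3⟩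
      · exact ⟨b, ⟨h3 ▸ h1, h2.2⟩, h3.symm, rfl⟩
      · exact absurd ((congrArg Prod.fst h2).symm.trans h3) (externalNeighbor_fst_ne hn (x, y))
    · rintro ⟨c, ⟨h1, h2⟩, rfl, rfl⟩
      exact ⟨⟨h1, Or.inl ⟨rfl, h2⟩⟩, rfl⟩
  · rw [← card_singleton (externalNeighbor (x, y)), ← card_empty (α := _ × _), ← apply_ite card]
    congr 1
    ext u
    simp only [mem_filter, network_adj_iff hn]
    constructor
    · rintro ⟨⟨h1, h2 | h2⟩, h3⟩
      · exact absurd h2.1.symm h3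
      · subst h2
        simp [h1]
    · split_ifs with h
      · intro hu
        rw [mem_singleton] at hu
        subst hu
        exact ⟨⟨h, Or.inr rfl⟩, externalNeighbor_fst_ne hn (x, y)⟩
      · simp

theorem HasInnerDegree.row (hn : 1 ≤ n) {h : ℕ} {A : Finset ((Fin n → Bool) × (Fin n → Bool))}
    (hA : (hierarchicalCubicNetwork n).HasInnerDegree h A) (x : Fin n → Bool) :
    (binaryCube n).HasInnerDegree (h - 1) (row x A) := by
  intro y hy
  have := hA _ (mem_row.1 hy)
  rw [card_network_neighbors hn] at this
  split_ifs at this <;> omega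

/-- A set within one of the cubes has, apart from its boundary in this cube, as many boundary
vertices outside it as it has vertices: their external neighbours. -/
theorem le_card_outerBoundary_of_row (hn : 1 ≤ n) {h : ℕ}
    {A : Finset ((Fin n → Bool) × (Fin n → Bool))}
    (hA : A.Nonempty) (hd : (hierarchicalCubicNetwork n).HasInnerDegree h A) {x : Fin n → Bool}
    (hx : ∀ p ∈ A, p.1 = x) :
    2 ^ h * (n + 1 - h) ≤ #((hierarchicalCubicNetwork n).outerBoundary A) := by
  have hext : ∀ p ∈ A, externalNeighbor p ∉ A := fun p hp hq =>
    externalNeighbor_fst_ne hn p ((hx _ hq).trans (hx p hp).symm)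
  have himage : (row x A).image (Prod.mk x) = A := by
    ext ⟨a, b⟩
    simp only [mem_image, mem_row, Prod.mk.injEq]
    constructor
    · rintro ⟨c, hc, rfl, rfl⟩
      exact hc
    · intro hab
      obtain rfl : a = x := hx _ hab
      exact ⟨b, hab, rfl, rfl⟩
  have hcard : #(row x A) = #A := by
    rw [← card_image_of_injective (row x A) (Prod.mk_right_injective x), himage]
  have hne : (row x A).Nonempty := by rwa [← card_pos, hcard, card_pos]
  have hrow : (binaryCube n).HasInnerDegree h (row x A) := by
    intro y hy
    rw [mem_row] at hy
    have := hd _ hy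
    rwa [card_network_neighbors hn, if_neg (hext _ hy), add_zero] at this
  refine (le_card_add_card_outerBoundary hne hrow).trans ?_
  rw [hcard, ← card_image_of_injective A externalNeighbor_injective,
    ← card_image_of_injective ((binaryCube n).outerBoundary _) (Prod.mk_right_injective x),
    ← card_union_of_disjoint]
  · refine card_le_card (union_subset ?_ ?_)
    · intro q hq
      obtain ⟨p, hp, rfl⟩ := mem_image.1 hq
      exact mem_outerBoundary.2 ⟨hext p hp, p, hp, (network_adj_iff hn).2 (Or.inr rfl)⟩
    · intro q hq
      obtain ⟨y, hy, rfl⟩ := mem_image.1 hq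
      obtain ⟨hy, z, hz, hzy⟩ := mem_outerBoundary.1 hy
      exact mem_outerBoundary.2 ⟨fun h => hy (mem_row.2 h), _, mem_row.1 hz,
        (network_adj_iff hn).2 (Or.inl ⟨rfl, hzy⟩)⟩
  · rw [Finset.disjoint_left]
    intro q hq hq'
    obtain ⟨p, hp, rfl⟩ := mem_image.1 hq
    obtain ⟨y, hy, hyq⟩ := mem_image.1 hq'
    exact externalNeighbor_fst_ne hn p ((congrArg Prod.fst hyq).symm.trans (hx p hp).symm)

theorem cutCost_row_le (hn : 1 ≤ n) (A B : Finset ((Fin n → Bool) × (Fin n → Bool)))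
    (x : Fin n → Bool) :
    (binaryCube n).cutCost (row x A) (row x B) ≤
      ∑ y, (hierarchicalCubicNetwork n).cutWeight A B (x, y) := by
  rw [cutCost_eq_sum]
  refine sum_le_sum fun y _ => ?_
  simp only [cutWeight, mem_row]
  gcongr
  split_ifs
  · simp only [adj_comm _ _ y, adj_comm _ _ (x, y), card_network_neighbors hn]
    omega
  · rfl

/-- The edge joining the cubes of `x` and `y` has to be cut if `B` does not meet the first one and
`A` does not meet the second one. -/
theorem one_le_cutWeight_add_cutWeight (hn : 1 ≤ n)
    {A B : Finset ((Fin n → Bool) × (Fin n → Bool))} {x y : Fin n → Bool} (hxy : x ≠ y)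
    (hx : row x B = ∅) (hy : row y A = ∅) :
    1 ≤ (hierarchicalCubicNetwork n).cutWeight A B (x, y) +
      (hierarchicalCubicNetwork n).cutWeight A B (y, x) := by
  have hxB : (x, y) ∉ B := fun h => by simpa [hx] using mem_row.2 h
  have hyA : (y, x) ∉ A := fun h => by simpa [hy] using mem_row.2 h
  by_cases hxA : (x, y) ∈ A
  · refine le_add_left (one_le_cutWeight (mem_outerBoundary.2 ⟨hyA, _, hxA, ?_⟩))
    exact (network_adj_iff hn).2 (Or.inr (externalNeighbor_of_ne hxy).symm)
  · refine le_add_right ?_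
    simp [cutWeight, hxA, hxB]

theorem two_pow_mul_le {h : ℕ} (hh : h ≤ n) : 2 ^ h * (n + 1 - h) ≤ 2 ^ n := by
  calc 2 ^ h * (n + 1 - h) ≤ 2 ^ h * 2 ^ (n - h) := by
        have : n - h < 2 ^ (n - h) := Nat.lt_two_pow_self
        exact Nat.mul_le_mul_left _ (by omega)
    _ = 2 ^ n := by rw [← pow_add]; congr 1; omega

/-- A cube which meets both sides accounts for at least half of the asserted cost, by the
corresponding result on the cube. -/
theorem le_two_mul_cutCost_row (hn : 1 ≤ n) {h : ℕ}
    {A B : Finset ((Fin n → Bool) × (Fin n → Bool))} (hAB : Disjoint A B)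
    (hdA : (hierarchicalCubicNetwork n).HasInnerDegree h A)
    (hdB : (hierarchicalCubicNetwork n).HasInnerDegree h B) {x : Fin n → Bool}
    (hA : (row x A).Nonempty) (hB : (row x B).Nonempty) :
    2 ^ h * (n + 1 - h) ≤ 2 * (binaryCube n).cutCost (row x A) (row x B) := by
  have hdisj : Disjoint (row x A) (row x B) := by
    rw [Finset.disjoint_left] at hAB ⊢
    intro y hy
    simpa using hAB (mem_row.1 hy)
  have := le_cutCost_cube hdisj hA hB (hdA.row hn x) (hdB.row hn x)
  rcases h with _ | h
  · simp only [zero_tsub, pow_zero, one_mul] at this ⊢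
    omega
  · rw [add_tsub_cancel_right] at this
    have : 2 ^ (h + 1) * (n + 1 - (h + 1)) = 2 * (2 ^ h * (n - h)) := by
      rw [pow_succ, Nat.add_sub_add_right]; ring
    omega

/-- The lower bound for both super connectivities of the network: separating `A` from `B` by
deleting vertices and edges costs at least `2 ^ h * (n + 1 - h)`. -/
theorem le_cutCost_network (hn : 1 ≤ n) {h : ℕ} (hh : h ≤ n)
    {A B : Finset ((Fin n → Bool) × (Fin n → Bool))} (hAB : Disjoint A B)
    (hA : A.Nonempty) (hB : B.Nonempty)
    (hdA : (hierarchicalCubicNetwork n).HasInnerDegree h A)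
    (hdB : (hierarchicalCubicNetwork n).HasInnerDegree h B) :
    2 ^ h * (n + 1 - h) ≤ (hierarchicalCubicNetwork n).cutCost A B := by
  have one_row : ∀ {A B : Finset ((Fin n → Bool) × (Fin n → Bool))}, A.Nonempty →
      (hierarchicalCubicNetwork n).HasInnerDegree h A → #{x | (row x A).Nonempty} ≤ 1 →
      2 ^ h * (n + 1 - h) ≤ (hierarchicalCubicNetwork n).cutCost A B := by
    intro A B hA hd hc
    obtain ⟨p, hp⟩ := hA
    refine (le_card_outerBoundary_of_row hn ⟨p, hp⟩ hd (x := p.1) fun q hq => ?_).trans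
      (card_outerBoundary_le_cutCost A B)
    exact card_le_one.1 hc _ (mem_filter.2 ⟨mem_univ _, q.2, mem_row.2 hq⟩) _
      (mem_filter.2 ⟨mem_univ _, p.2, mem_row.2 hp⟩)
  set RA : Finset (Fin n → Bool) := {x | (row x A).Nonempty} with hRA
  set RB : Finset (Fin n → Bool) := {x | (row x B).Nonempty} with hRB
  by_cases ha : #RA ≤ 1
  · exact one_row hA hdA ha
  by_cases hb : #RB ≤ 1
  · rw [cutCost_comm]
    exact one_row hB hdB hb
  have hsum : (hierarchicalCubicNetwork n).cutCost A B =
      ∑ x, ∑ y, (hierarchicalCubicNetwork n).cutWeight A B (x, y) := by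
    rw [cutCost_eq_sum, Fintype.sum_prod_type]
  have hcube : Fintype.card (Fin n → Bool) = 2 ^ n := by simp
  have hM := two_pow_mul_le hh
  by_cases hU : RA ∪ RB = univ
  swap
  · -- Some cube meets neither `A` nor `B`, so all of its vertices are deleted.
    obtain ⟨x, hx⟩ : ∃ x, x ∉ RA ∪ RB := by
      by_contra! hall
      exact hU (eq_univ_iff_forall.2 hall)
    have hx' : row x A = ∅ ∧ row x B = ∅ := by simpa [hRA, hRB] using hx
    have h1 := cutCost_row_le hn A B x
    rw [hx'.1, hx'.2] at h1
    have h2 : 2 ^ n ≤ (binaryCube n).cutCost ∅ ∅ := by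
      simp [cutCost, interedges, Rel.interedges]
    rw [hsum]
    refine (hM.trans (h2.trans h1)).trans ?_
    exact single_le_sum (f := fun x => ∑ y, (hierarchicalCubicNetwork n).cutWeight A B (x, y))
      (fun _ _ => Nat.zero_le _) (mem_univ x)
  have hmixed : #(RA ∩ RB) * (2 ^ h * (n + 1 - h)) ≤
      2 * ∑ x ∈ RA ∩ RB, ∑ y, (hierarchicalCubicNetwork n).cutWeight A B (x, y) := by
    rw [mul_sum, ← smul_eq_mul]
    refine card_nsmul_le_sum _ _ _ fun x hx => ?_
    simp only [hRA, hRB, mem_inter, mem_filter, mem_univ, true_and] at hx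
    exact (le_two_mul_cutCost_row hn hAB hdA hdB hx.1 hx.2).trans
      (Nat.mul_le_mul_left 2 (cutCost_row_le hn A B x))
  have hpure : #RBᶜ * #RAᶜ ≤ ∑ x ∈ RBᶜ, ∑ y, (hierarchicalCubicNetwork n).cutWeight A B (x, y) +
      ∑ x ∈ RAᶜ, ∑ y, (hierarchicalCubicNetwork n).cutWeight A B (x, y) := by
    calc #RBᶜ * #RAᶜ = ∑ x ∈ RBᶜ, ∑ y ∈ RAᶜ, 1 := by simp
      _ ≤ ∑ x ∈ RBᶜ, ∑ y ∈ RAᶜ, ((hierarchicalCubicNetwork n).cutWeight A B (x, y) +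
            (hierarchicalCubicNetwork n).cutWeight A B (y, x)) := by
          refine sum_le_sum fun x hx => sum_le_sum fun y hy => ?_
          refine one_le_cutWeight_add_cutWeight hn ?_ (by simpa [hRB] using hx)
            (by simpa [hRA] using hy)
          rintro rfl
          have := eq_univ_iff_forall.1 hU x
          rw [mem_compl] at hx hy
          simp [hx, hy] at this
      _ = ∑ x ∈ RBᶜ, ∑ y ∈ RAᶜ, (hierarchicalCubicNetwork n).cutWeight A B (x, y) +
            ∑ x ∈ RAᶜ, ∑ y ∈ RBᶜ, (hierarchicalCubicNetwork n).cutWeight A B (x, y) := by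
          simp only [sum_add_distrib]
          rw [sum_comm (s := RAᶜ)]
      _ ≤ _ := add_le_add
          (sum_le_sum fun x _ => sum_le_sum_of_subset (subset_univ _))
          (sum_le_sum fun x _ => sum_le_sum_of_subset (subset_univ _))
  have hsplit : ∑ x, ∑ y, (hierarchicalCubicNetwork n).cutWeight A B (x, y) =
      ∑ x ∈ RBᶜ, ∑ y, (hierarchicalCubicNetwork n).cutWeight A B (x, y) +
      ∑ x ∈ RAᶜ, ∑ y, (hierarchicalCubicNetwork n).cutWeight A B (x, y) +
      ∑ x ∈ RA ∩ RB, ∑ y, (hierarchicalCubicNetwork n).cutWeight A B (x, y) := by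
    have hdisj : Disjoint RBᶜ RAᶜ := by
      rw [Finset.disjoint_left]
      intro x hx hx'
      have := eq_univ_iff_forall.1 hU x
      rw [mem_compl] at hx hx'
      simp [hx, hx'] at this
    rw [← sum_add_sum_compl (RA ∩ RB), add_comm, compl_inter, union_comm, sum_union hdisj]
  have hcA := card_add_card_compl RA
  have hcB := card_add_card_compl RB
  have hcU := card_union_add_card_inter RA RB
  rw [hU, card_univ] at hcU
  rw [hcube] at hcA hcB hcU
  rw [hsum, hsplit]
  -- With `a` cubes avoiding `B`, `b` cubes avoiding `A` and `c` cubes meeting both, twice the cost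
  -- is at least `2 * a * b + c * (2 ^ h * (n + 1 - h))`, where `a + b + c = 2 ^ n`, and `a + c`
  -- and `b + c` are at least `2`.
  have h4 : 4 ≤ 2 ^ n ∨ 2 ≤ #(RA ∩ RB) := by
    by_cases h2 : 2 ≤ n
    · exact Or.inl (Nat.pow_le_pow_right (by norm_num : 0 < 2) h2)
    · obtain rfl : n = 1 := by omega
      right
      omega
  set a := #RBᶜ
  set b := #RAᶜ
  set c := #(RA ∩ RB)
  by_cases hc : 2 ≤ c
  · have := (Nat.mul_le_mul_right (2 ^ h * (n + 1 - h)) hc).trans hmixed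
    omega
  have h4 := h4.resolve_right hc
  obtain hc | hc : c = 0 ∨ c = 1 := by omega
  · obtain ⟨a', ha'⟩ : ∃ a', a = a' + 2 := ⟨a - 2, by omega⟩
    obtain ⟨b', hb'⟩ : ∃ b', b = b' + 2 := ⟨b - 2, by omega⟩
    have : 2 ^ n ≤ a * b := by
      have : (a' + 2) * (b' + 2) = a' * b' + 2 * a' + 2 * b' + 4 := by ring
      rw [ha', hb']
      omega
    omega
  · obtain ⟨a', ha'⟩ : ∃ a', a = a' + 1 := ⟨a - 1, by omega⟩
    obtain ⟨b', hb'⟩ : ∃ b', b = b' + 1 := ⟨b - 1, by omega⟩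
    have : 2 ^ n ≤ 2 * (a * b) := by
      have : (a' + 1) * (b' + 1) = a' * b' + a' + b' + 1 := by ring
      rw [ha', hb']
      omega
    rw [hc, one_mul] at hmixed
    omega

end Network

/-! ### Cuts as separations of two vertex sets -/

section CutsAndCost

theorem mem_of_reachable {V : Type*} {H : SimpleGraph V} {X : Set V}
    (hX : ∀ u v, u ∈ X → H.Adj u v → v ∈ X) {u v : V} (hu : u ∈ X) (h : H.Reachable u v) :
    v ∈ X := by
  obtain ⟨p⟩ := h
  induction p with
  | nil => exact hu
  | cons huv _ ih => exact ih (hX _ _ hu huv)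

theorem le_minDegree_iff {V : Type*} [Nonempty V] {H : SimpleGraph V} {_ : Fintype V}
    {_ : DecidableRel H.Adj} {h : ℕ} : h ≤ H.minDegree ↔ ∀ v, h ≤ #{u | H.Adj v u} := by
  have hdeg : ∀ v, H.degree v = #{u | H.Adj v u} := fun v => by
    rw [← card_neighborFinset_eq_degree, neighborFinset_eq_filter]
  simp only [← hdeg]
  exact ⟨fun hd v => hd.trans (H.minDegree_le_degree v),
    fun hd => H.le_minDegree_of_forall_le_degree h hd⟩

theorem card_interedges_le_of_subset {V : Type*} {G : SimpleGraph V} [DecidableRel G.Adj]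
    {A B : Finset V} (hAB : Disjoint A B) {F : Finset (Sym2 V)}
    (hF : ∀ u ∈ A, ∀ v ∈ B, G.Adj u v → s(u, v) ∈ F) : #(G.interedges A B) ≤ #F := by
  refine card_le_card_of_injOn (fun p => s(p.1, p.2)) ?_ ?_
  · rintro ⟨u, v⟩ huv
    rw [mem_coe, mk_mem_interedges_iff] at huv
    exact hF u huv.1 v huv.2.1 huv.2.2
  · rintro ⟨u, v⟩ huv ⟨u', v'⟩ huv' h
    rw [mem_coe, mk_mem_interedges_iff] at huv huv'
    rcases Sym2.eq_iff.1 h with ⟨h1, h2⟩ | ⟨h1, -⟩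
    · exact Prod.ext h1 h2
    · exact absurd huv'.2.1 (Finset.disjoint_left.1 hAB ((show u = v' from h1) ▸ huv.1))

variable {V : Type*} [Fintype V] [DecidableEq V] {G : SimpleGraph V} [DecidableRel G.Adj]

theorem isSuperVertexCut_iff {h : ℕ} {S : Finset V} :
    G.IsSuperVertexCut h S ↔ ¬ (G.induce {v | v ∉ S}).Preconnected ∧
      ∀ v, v ∉ S → h ≤ #{u ∈ Sᶜ | G.Adj v u} := by
  refine and_congr_right fun hc => ?_
  have : Nonempty {v | v ∉ S} := by
    by_contra hne
    exact hc fun u => (hne ⟨u⟩).elim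
  rw [le_minDegree_iff, Subtype.forall]
  refine forall₂_congr fun v hv => ?_
  rw [← card_map (Function.Embedding.subtype _)]
  refine iff_of_eq (congrArg (h ≤ #·) ?_)
  ext u
  simp [and_comm]

theorem isSuperEdgeCut_iff {h : ℕ} {F : Finset (Sym2 V)} :
    G.IsSuperEdgeCut h F ↔ (F : Set (Sym2 V)) ⊆ G.edgeSet ∧
      ¬ (G.deleteEdges (F : Set (Sym2 V))).Preconnected ∧
      ∀ v, h ≤ #{u | G.Adj v u ∧ s(v, u) ∉ F} := by
  refine and_congr_right fun _ => and_congr_right fun hc => ?_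
  have : Nonempty V := by
    by_contra hne
    exact hc fun u => (hne ⟨u⟩).elim
  rw [le_minDegree_iff]
  refine forall_congr' fun v => iff_of_eq (congrArg (h ≤ #·) ?_)
  ext u
  simp [deleteEdges_adj]

/-- A vertex cut separates one connected component of the remaining graph from the others. -/
theorem IsSuperVertexCut.exists_cutCost_le {h : ℕ} {S : Finset V} (hS : G.IsSuperVertexCut h S) :
    ∃ A B : Finset V, Disjoint A B ∧ A.Nonempty ∧ B.Nonempty ∧ G.HasInnerDegree h A ∧
      G.HasInnerDegree h B ∧ G.cutCost A B ≤ #S := by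
  classical
  obtain ⟨hc, hdeg⟩ := isSuperVertexCut_iff.1 hS
  simp only [Preconnected, not_forall] at hc
  obtain ⟨a, b, hab⟩ := hc
  set H := G.induce {v | v ∉ S}
  have hadj : ∀ u v (hu : u ∉ S) (hv : v ∉ S), G.Adj u v →
      (H.Reachable a ⟨u, hu⟩ ↔ H.Reachable a ⟨v, hv⟩) := fun u v hu hv huv => by
    have : H.Adj ⟨u, hu⟩ ⟨v, hv⟩ := huv
    exact ⟨fun h => h.trans this.reachable, fun h => h.trans this.symm.reachable⟩
  refine ⟨univ.filter fun v => ∃ hv : v ∉ S, H.Reachable a ⟨v, hv⟩,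
    univ.filter fun v => ∃ hv : v ∉ S, ¬ H.Reachable a ⟨v, hv⟩, ?_, ⟨a, ?_⟩, ⟨b, ?_⟩, ?_, ?_, ?_⟩
  · rw [Finset.disjoint_left]
    intro v hv hv'
    obtain ⟨h1, h2⟩ := (mem_filter.1 hv).2
    obtain ⟨_, h3⟩ := (mem_filter.1 hv').2
    exact h3 h2
  · exact mem_filter.2 ⟨mem_univ _, a.2, Reachable.refl _⟩
  · exact mem_filter.2 ⟨mem_univ _, b.2, hab⟩
  · intro v hv
    obtain ⟨h1, h2⟩ := (mem_filter.1 hv).2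
    refine (hdeg v h1).trans (card_le_card fun u hu => ?_)
    rw [mem_filter, mem_compl] at hu
    exact mem_filter.2 ⟨mem_filter.2 ⟨mem_univ _, hu.1, (hadj v u h1 hu.1 hu.2).1 h2⟩, hu.2⟩
  · intro v hv
    obtain ⟨h1, h2⟩ := (mem_filter.1 hv).2
    refine (hdeg v h1).trans (card_le_card fun u hu => ?_)
    rw [mem_filter, mem_compl] at hu
    exact mem_filter.2
      ⟨mem_filter.2 ⟨mem_univ _, hu.1, fun h => h2 ((hadj v u h1 hu.1 hu.2).2 h)⟩, hu.2⟩
  · refine (add_le_add (?_ : _ ≤ #S) (card_eq_zero.2 ?_).le).trans_eq (add_zero _)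
    · refine card_le_card fun v hv => ?_
      by_contra hvS
      rw [mem_compl, mem_union, mem_filter, mem_filter] at hv
      by_cases hr : H.Reachable a ⟨v, hvS⟩
      · exact hv (Or.inl ⟨mem_univ _, hvS, hr⟩)
      · exact hv (Or.inr ⟨mem_univ _, hvS, hr⟩)
    · rw [eq_empty_iff_forall_notMem]
      rintro ⟨u, v⟩ huv
      rw [mk_mem_interedges_iff, mem_filter, mem_filter] at huv
      obtain ⟨⟨-, hu, hu'⟩, ⟨-, hv, hv'⟩, huv⟩ := huv
      exact hv' ((hadj u v hu hv huv).1 hu')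

/-- An edge cut separates one connected component of the remaining graph from the others. -/
theorem IsSuperEdgeCut.exists_cutCost_le {h : ℕ} {F : Finset (Sym2 V)}
    (hF : G.IsSuperEdgeCut h F) :
    ∃ A B : Finset V, Disjoint A B ∧ A.Nonempty ∧ B.Nonempty ∧ G.HasInnerDegree h A ∧
      G.HasInnerDegree h B ∧ G.cutCost A B ≤ #F := by
  classical
  obtain ⟨-, hc, hdeg⟩ := isSuperEdgeCut_iff.1 hF
  simp only [Preconnected, not_forall] at hc
  obtain ⟨a, b, hab⟩ := hc
  set H := G.deleteEdges (F : Set (Sym2 V))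
  have hadj : ∀ u v, G.Adj u v → s(u, v) ∉ F →
      (H.Reachable a u ↔ H.Reachable a v) := fun u v huv hF => by
    have : H.Adj u v := deleteEdges_adj.2 ⟨huv, by simpa using hF⟩
    exact ⟨fun h => h.trans this.reachable, fun h => h.trans this.symm.reachable⟩
  have hdisj : Disjoint (univ.filter fun v => H.Reachable a v)
      (univ.filter fun v => ¬ H.Reachable a v) := disjoint_filter_filter_not _ _ _
  refine ⟨_, _, hdisj, ⟨a, ?_⟩, ⟨b, ?_⟩, ?_, ?_, ?_⟩
  · exact mem_filter.2 ⟨mem_univ _, Reachable.refl _⟩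
  · exact mem_filter.2 ⟨mem_univ _, hab⟩
  · intro v hv
    refine (hdeg v).trans (card_le_card fun u hu => ?_)
    rw [mem_filter] at hu hv
    exact mem_filter.2
      ⟨mem_filter.2 ⟨mem_univ _, (hadj v u hu.2.1 hu.2.2).1 hv.2⟩, hu.2.1⟩
  · intro v hv
    refine (hdeg v).trans (card_le_card fun u hu => ?_)
    rw [mem_filter] at hu hv
    exact mem_filter.2
      ⟨mem_filter.2 ⟨mem_univ _, fun h => hv.2 ((hadj v u hu.2.1 hu.2.2).2 h)⟩, hu.2.1⟩
  · rw [cutCost, filter_union_filter_not_eq, compl_univ, card_empty, zero_add]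
    refine card_interedges_le_of_subset hdisj fun u hu v hv huv => ?_
    by_contra hn
    exact (mem_filter.1 hv).2 ((hadj u v huv hn).1 (mem_filter.1 hu).2)

theorem isSuperVertexCut_outerBoundary {h : ℕ} {X : Finset V} (hX : X.Nonempty)
    (hY : (X ∪ G.outerBoundary X)ᶜ.Nonempty) (hdX : G.HasInnerDegree h X)
    (hdY : G.HasInnerDegree h (X ∪ G.outerBoundary X)ᶜ) :
    G.IsSuperVertexCut h (G.outerBoundary X) := by
  obtain ⟨a, ha⟩ := hX
  obtain ⟨b, hb⟩ := hY
  have hXS : ∀ v ∈ X, v ∉ G.outerBoundary X := fun v hv h => (mem_outerBoundary.1 h).1 hv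
  have hYS : ∀ v ∈ (X ∪ G.outerBoundary X)ᶜ, v ∉ G.outerBoundary X := fun v hv h =>
    mem_compl.1 hv (mem_union_right _ h)
  refine isSuperVertexCut_iff.2 ⟨fun hc => ?_, fun v hvS => ?_⟩
  · have := mem_of_reachable (X := {v | v.1 ∈ X}) ?_ ha (hc ⟨a, hXS a ha⟩ ⟨b, hYS b hb⟩)
    · exact mem_compl.1 hb (mem_union_left _ this)
    · intro u v hu huv
      by_contra hv
      exact v.2 (mem_outerBoundary.2 ⟨hv, u.1, hu, huv⟩)
  · by_cases hv : v ∈ X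
    · refine (hdX _ hv).trans (card_le_card (filter_subset_filter _ fun u hu => ?_))
      exact mem_compl.2 (hXS u hu)
    · have hv' : v ∈ (X ∪ G.outerBoundary X)ᶜ := by
        rw [mem_compl, mem_union, not_or]
        exact ⟨hv, hvS⟩
      refine (hdY _ hv').trans (card_le_card (filter_subset_filter _ fun u hu => ?_))
      exact mem_compl.2 (hYS u hu)

theorem isSuperEdgeCut_interedges {h : ℕ} {X : Finset V} (hX : X.Nonempty) (hY : Xᶜ.Nonempty)
    (hdX : G.HasInnerDegree h X) (hdY : G.HasInnerDegree h Xᶜ) :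
    G.IsSuperEdgeCut h ((G.interedges X Xᶜ).image fun p => s(p.1, p.2)) := by
  obtain ⟨a, ha⟩ := hX
  obtain ⟨b, hb⟩ := hY
  set F : Finset (Sym2 V) := (G.interedges X Xᶜ).image fun p => s(p.1, p.2) with hF
  have hmem : ∀ u v, s(u, v) ∈ F → (u ∈ X ↔ v ∉ X) := by
    intro u v huv
    rw [hF, mem_image] at huv
    obtain ⟨⟨u', v'⟩, h1, h2⟩ := huv
    rw [mk_mem_interedges_iff, mem_compl] at h1
    rcases Sym2.eq_iff.1 h2 with ⟨rfl, rfl⟩ | ⟨rfl, rfl⟩ <;> simp [h1]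
  refine isSuperEdgeCut_iff.2 ⟨?_, fun hc => ?_, fun v => ?_⟩
  · intro e he
    obtain ⟨⟨u, v⟩, huv, rfl⟩ := mem_image.1 (mem_coe.1 he)
    exact ((G.mk_mem_interedges_iff).1 huv).2.2
  · refine mem_compl.1 hb (mem_of_reachable (X := {v | v ∈ X}) ?_ ha (hc a b))
    intro u v hu huv
    rw [deleteEdges_adj] at huv
    by_contra hv
    refine huv.2 (mem_coe.2 (mem_image.2 ⟨(u, v), ?_, rfl⟩))
    exact (G.mk_mem_interedges_iff).2 ⟨hu, mem_compl.2 hv, huv.1⟩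
  · by_cases hv : v ∈ X
    · refine (hdX v hv).trans (card_le_card fun u hu => ?_)
      rw [mem_filter] at hu
      exact mem_filter.2 ⟨mem_univ _, hu.2, fun h => (hmem v u h).1 hv hu.1⟩
    · refine (hdY v (mem_compl.2 hv)).trans (card_le_card fun u hu => ?_)
      rw [mem_filter, mem_compl] at hu
      exact mem_filter.2 ⟨mem_univ _, hu.2, fun h => hv ((hmem v u h).2 hu.1)⟩

end CutsAndCost

/-! ### Minimum cuts from subcubes -/

section Subcube

variable {n : ℕ}

theorem binaryCube_adj_iff {y z : Fin n → Bool} :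
    (binaryCube n).Adj y z ↔ ∃ i, Function.update y i (!y i) = z := by
  change hammingDist y z = 1 ↔ _
  rw [hammingDist, card_eq_one]
  refine exists_congr fun i => ?_
  simp only [Finset.ext_iff, mem_filter, mem_univ, true_and, mem_singleton, funext_iff,
    Function.update_apply]
  refine forall_congr' fun j => ?_
  by_cases h : j = i
  · subst h
    cases y j <;> cases z j <;> simp
  · simp [h]

theorem card_cube_neighbors (A : Finset (Fin n → Bool)) (y : Fin n → Bool) :
    #{z ∈ A | (binaryCube n).Adj y z} = #{i | Function.update y i (!y i) ∈ A} := by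
  have hinj : Function.Injective fun i => Function.update y i (!y i) := by
    intro i j hij
    by_contra h
    simpa [h] using congrFun hij i
  rw [← card_image_of_injective _ hinj]
  congr 1
  ext z
  simp only [mem_filter, binaryCube_adj_iff, mem_image, mem_univ, true_and]
  constructor
  · rintro ⟨h, i, rfl⟩
    exact ⟨i, h, rfl⟩
  · rintro ⟨i, h, rfl⟩
    exact ⟨h, i, rfl⟩

theorem card_neighbors (hn : 1 ≤ n) (p : (Fin n → Bool) × (Fin n → Bool)) :
    #{u | (hierarchicalCubicNetwork n).Adj p u} = n + 1 := by
  have : row p.1 univ = univ := by ext; simp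
  rw [card_network_neighbors hn, this, card_cube_neighbors]
  simp

/-- The subcube of dimension `h` (if `h ≤ n`) on which all but the first `h` coordinates vanish. -/
def subcube (n h : ℕ) : Finset (Fin n → Bool) :=
  {y | ∀ i : Fin n, h ≤ i → y i = false}

theorem mem_subcube {h : ℕ} {y : Fin n → Bool} :
    y ∈ subcube n h ↔ ∀ i : Fin n, h ≤ i → y i = false := by
  simp [subcube]

theorem card_coords_lt {h : ℕ} (hh : h ≤ n) : #{i : Fin n | i.val < h} = h := by
  rw [Fin.card_filter_val_lt, min_eq_right hh]

theorem card_subcube {h : ℕ} (hh : h ≤ n) : #(subcube n h) = 2 ^ h := by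
  have : subcube n h =
      Fintype.piFinset fun i : Fin n => if i.val < h then (univ : Finset Bool) else {false} := by
    ext y
    rw [mem_subcube, Fintype.mem_piFinset]
    refine forall_congr' fun i => ?_
    split_ifs with hi
    · simp [hi]
    · simp [not_lt.1 hi]
  rw [this, Fintype.card_piFinset]
  simp only [apply_ite card, card_univ, Fintype.card_bool, card_singleton]
  rw [prod_ite, prod_const, prod_const, one_pow, mul_one, card_coords_lt hh]

theorem hasInnerDegree_subcube {h : ℕ} (hh : h ≤ n) :
    (binaryCube n).HasInnerDegree h (subcube n h) := by
  intro y hy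
  rw [card_cube_neighbors]
  refine (card_coords_lt hh).symm.le.trans (card_le_card fun i hi => ?_)
  simp only [mem_filter, mem_univ, true_and, mem_subcube] at hi hy ⊢
  intro j hj
  rw [Function.update_of_ne (by rintro rfl; omega)]
  exact hy j hj

/-- A vertex outside the subcube has at most one neighbour in it: the coordinate to be flipped is
determined. -/
theorem card_neighbors_subcube_le {h : ℕ} {y : Fin n → Bool} (hy : y ∉ subcube n h) :
    #{z ∈ subcube n h | (binaryCube n).Adj y z} ≤ 1 := by
  rw [card_cube_neighbors]
  simp only [mem_subcube, not_forall] at hy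
  obtain ⟨i, hi, hyi⟩ := hy
  refine (card_le_card fun j hj => ?_).trans (card_singleton i).le
  simp only [mem_filter, mem_univ, true_and, mem_subcube] at hj
  rw [mem_singleton]
  by_contra hne
  have := hj i hi
  rw [Function.update_of_ne (Ne.symm hne)] at this
  exact hyi this

/-- A vertex at distance at least `2` from the subcube has at most two neighbours at distance `1`
from it. -/
theorem card_neighbors_outerBoundary_subcube_le {h : ℕ} {y : Fin n → Bool}
    (hy : y ∉ subcube n h) (hy' : y ∉ (binaryCube n).outerBoundary (subcube n h)) :
    #{z ∈ (binaryCube n).outerBoundary (subcube n h) | (binaryCube n).Adj y z} ≤ 2 := by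
  obtain ⟨i, hi, hyi⟩ : ∃ i : Fin n, h ≤ i ∧ ¬ y i = false := by
    simpa [mem_subcube] using hy
  -- Flipping the coordinate `i` does not lead into the subcube, so there is another coordinate
  -- which does not vanish.
  obtain ⟨j, hj, hij, hyj⟩ : ∃ j : Fin n, h ≤ j ∧ j ≠ i ∧ ¬ y j = false := by
    by_contra! hall
    refine hy' (mem_outerBoundary.2 ⟨hy, Function.update y i (!y i), mem_subcube.2 ?_,
      (binaryCube_adj_iff.2 ⟨i, rfl⟩).symm⟩)
    intro j hj
    by_cases hji : j = i
    · subst hji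
      simpa using hyi
    · rw [Function.update_of_ne hji]
      exact hall j hj hji
  rw [card_cube_neighbors]
  refine (card_le_card fun k hk => ?_).trans (card_le_two (a := i) (b := j))
  simp only [mem_filter, mem_univ, true_and, mem_outerBoundary] at hk
  obtain ⟨-, u, hu, huk⟩ := hk
  obtain ⟨l, hl⟩ := binaryCube_adj_iff.1 huk.symm
  rw [mem_insert, mem_singleton]
  by_contra! hne
  rw [mem_subcube] at hu
  -- At most one of the coordinates `i` and `j` is flipped on the way to the subcube.
  have flip : ∀ m : Fin n, h ≤ m → m ≠ k → ¬ y m = false → m = l := by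
    intro m hm hmk hym
    by_contra hml
    have := hu m hm
    rw [← hl, Function.update_of_ne hml, Function.update_of_ne hmk] at this
    exact hym this
  exact hij ((flip j hj hne.2.symm hyj).trans (flip i hi hne.1.symm hyi).symm)

/-- The subcube of dimension `h` of the cube `{0} × Q_n`. -/
def networkSubcube (n h : ℕ) : Finset ((Fin n → Bool) × (Fin n → Bool)) :=
  (subcube n h).image (Prod.mk fun _ => false)

theorem mem_networkSubcube {h : ℕ} {p : (Fin n → Bool) × (Fin n → Bool)} :
    p ∈ networkSubcube n h ↔ p.1 = (fun _ => false) ∧ p.2 ∈ subcube n h := by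
  obtain ⟨x, y⟩ := p
  simp [networkSubcube, eq_comm, and_comm]

theorem row_networkSubcube (n h : ℕ) :
    row (fun _ => false) (networkSubcube n h) = subcube n h := by
  ext y
  simp [mem_networkSubcube]

theorem row_networkSubcube_of_ne {h : ℕ} {x : Fin n → Bool} (hx : x ≠ fun _ => false) :
    row x (networkSubcube n h) = ∅ := by
  ext y
  simp [mem_networkSubcube, hx]

theorem zero_mem_networkSubcube (n h : ℕ) :
    ((fun _ => false, fun _ => false) : (Fin n → Bool) × (Fin n → Bool)) ∈ networkSubcube n h :=
  mem_networkSubcube.2 ⟨rfl, mem_subcube.2 fun _ _ => rfl⟩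

theorem hasInnerDegree_networkSubcube (hn : 1 ≤ n) {h : ℕ} (hh : h ≤ n) :
    (hierarchicalCubicNetwork n).HasInnerDegree h (networkSubcube n h) := by
  rintro ⟨x, y⟩ hp
  obtain ⟨rfl, hy⟩ := mem_networkSubcube.1 hp
  rw [card_network_neighbors hn, row_networkSubcube]
  exact (hasInnerDegree_subcube hh y hy).trans (Nat.le_add_right _ _)

theorem card_network_neighbors_add (hn : 1 ≤ n) (A : Finset ((Fin n → Bool) × (Fin n → Bool)))
    (p : (Fin n → Bool) × (Fin n → Bool)) :
    #{u ∈ A | (hierarchicalCubicNetwork n).Adj p u} +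
      #{u ∈ Aᶜ | (hierarchicalCubicNetwork n).Adj p u} = n + 1 := by
  rw [← card_neighbors hn p, ← card_union_of_disjoint, ← filter_union, union_compl]
  exact disjoint_filter_filter disjoint_compl_right

theorem hasInnerDegree_compl_networkSubcube (hn : 1 ≤ n) (h : ℕ) :
    (hierarchicalCubicNetwork n).HasInnerDegree n (networkSubcube n h)ᶜ := by
  rintro ⟨x, y⟩ hp
  rw [mem_compl, mem_networkSubcube] at hp
  have := card_network_neighbors_add hn (networkSubcube n h) (x, y)
  have h1 := card_network_neighbors hn (networkSubcube n h) x y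
  by_cases hx : x = fun _ => false
  · subst hx
    have h2 := card_neighbors_subcube_le (h := h) (y := y) (by simpa using hp)
    rw [row_networkSubcube, if_neg] at h1
    · omega
    · exact fun h => externalNeighbor_fst_ne hn _ (mem_networkSubcube.1 h).1
  · rw [row_networkSubcube_of_ne hx, filter_empty, card_empty] at h1
    split_ifs at h1 <;> omega

theorem cutCost_networkSubcube_le (hn : 1 ≤ n) {h : ℕ} (hh : h ≤ n) :
    (hierarchicalCubicNetwork n).cutCost (networkSubcube n h) (networkSubcube n h)ᶜ ≤
      2 ^ h * (n + 1 - h) := by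
  rw [cutCost, union_compl, compl_univ, card_empty, zero_add, interedges, Rel.interedges,
    card_filter, sum_product]
  simp only [← card_filter]
  refine (sum_le_card_nsmul _ _ (n + 1 - h) fun p hp => ?_).trans ?_
  · have h1 := card_network_neighbors_add hn (networkSubcube n h) p
    have h2 := hasInnerDegree_networkSubcube hn hh p hp
    omega
  · rw [smul_eq_mul, ← card_subcube hh]
    exact Nat.mul_le_mul_right _ card_image_le

theorem one_ne_zero_vector (hn : 1 ≤ n) : (fun _ : Fin n => true) ≠ fun _ => false := fun h => by
  simpa using congrFun h ⟨0, hn⟩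

/-- Outside the cube containing `networkSubcube`, the boundary consists of external neighbours. -/
theorem externalNeighbor_mem_of_mem_outerBoundary (hn : 1 ≤ n) {h : ℕ}
    {p : (Fin n → Bool) × (Fin n → Bool)} (hp : p.1 ≠ fun _ => false)
    (h' : p ∈ (hierarchicalCubicNetwork n).outerBoundary (networkSubcube n h)) :
    externalNeighbor p ∈ networkSubcube n h := by
  obtain ⟨-, u, hu, hup⟩ := mem_outerBoundary.1 h'
  rcases (network_adj_iff hn).1 hup.symm with ⟨h1, -⟩ | h1
  · exact absurd (h1.trans (mem_networkSubcube.1 hu).1) hp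
  · exact h1 ▸ hu

/-- Each cube other than the one containing `networkSubcube` contains at most one vertex of the
boundary. -/
theorem card_row_outerBoundary_le (hn : 1 ≤ n) {h : ℕ} (hh : h < n) {x : Fin n → Bool}
    (hx : x ≠ fun _ => false) :
    #(row x ((hierarchicalCubicNetwork n).outerBoundary (networkSubcube n h))) ≤ 1 := by
  have key : ∀ y, (x, y) ∈ (hierarchicalCubicNetwork n).outerBoundary (networkSubcube n h) →
      (x = y ∧ x = fun _ => true) ∨ ((y = fun _ => false) ∧ x ∈ subcube n h) := by
    intro y hy
    have h1 := mem_networkSubcube.1 (externalNeighbor_mem_of_mem_outerBoundary hn hx hy)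
    by_cases hxy : x = y
    · refine Or.inl ⟨hxy, ?_⟩
      simp only [externalNeighbor, hxy, if_true] at h1
      rw [hxy, ← bitCompl_bitCompl y, h1.1]
      rfl
    · rw [externalNeighbor_of_ne hxy] at h1
      exact Or.inr h1
  have hone : (fun _ : Fin n => true) ∉ subcube n h := fun h1 => by
    simpa using mem_subcube.1 h1 ⟨h, hh⟩ le_rfl
  refine card_le_one.2 fun y hy z hz => ?_
  rcases key y (mem_row.1 hy) with ⟨h1, h2⟩ | ⟨h1, h2⟩ <;>
    rcases key z (mem_row.1 hz) with ⟨h3, h4⟩ | ⟨h3, h4⟩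
  · exact h1.symm.trans h3
  · exact absurd (h2 ▸ h4) hone
  · exact absurd (h4 ▸ h2) hone
  · exact h1.trans h3.symm

theorem row_outerBoundary_networkSubcube (hn : 1 ≤ n) (h : ℕ) :
    row (fun _ => false) ((hierarchicalCubicNetwork n).outerBoundary (networkSubcube n h)) =
      (binaryCube n).outerBoundary (subcube n h) := by
  ext y
  rw [mem_row, mem_outerBoundary, mem_outerBoundary, ← mem_row, row_networkSubcube]
  refine and_congr_right fun _ => ⟨?_, ?_⟩
  · rintro ⟨u, hu, huy⟩
    have hu' := mem_networkSubcube.1 hu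
    rcases (network_adj_iff hn).1 huy with ⟨-, h1⟩ | h1
    · exact ⟨u.2, hu'.2, h1⟩
    · exact absurd ((congrArg Prod.fst h1).symm.trans hu'.1.symm) (externalNeighbor_fst_ne hn u)
  · rintro ⟨z, hz, hzy⟩
    exact ⟨(fun _ => false, z), mem_networkSubcube.2 ⟨rfl, hz⟩,
      (network_adj_iff hn).2 (Or.inl ⟨rfl, hzy⟩)⟩

/-- Deleting the boundary of `networkSubcube` lowers the degrees of the vertices outside the
closed neighbourhood by at most `2`. -/
theorem hasInnerDegree_compl_closedNeighborhood (hn : 1 ≤ n) {h : ℕ} (hh : h < n) :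
    (hierarchicalCubicNetwork n).HasInnerDegree (n - 1)
      (networkSubcube n h ∪
        (hierarchicalCubicNetwork n).outerBoundary (networkSubcube n h))ᶜ := by
  rintro ⟨x, y⟩ hp
  set S := (hierarchicalCubicNetwork n).outerBoundary (networkSubcube n h) with hS
  rw [mem_compl, mem_union, not_or] at hp
  -- No neighbour of `(x, y)` is in `networkSubcube n h`.
  have h1 : #{u ∈ (networkSubcube n h ∪ S)ᶜ | (hierarchicalCubicNetwork n).Adj (x, y) u} =
      #{u ∈ Sᶜ | (hierarchicalCubicNetwork n).Adj (x, y) u} := by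
    congr 1
    ext u
    simp only [mem_filter, mem_compl, mem_union, not_or]
    refine ⟨fun h => ⟨h.1.2, h.2⟩, fun h => ⟨⟨fun hu => ?_, h.1⟩, h.2⟩⟩
    exact hp.2 (mem_outerBoundary.2 ⟨hp.1, u, hu, h.2.symm⟩)
  have h2 := card_network_neighbors_add hn S (x, y)
  have h3 := card_network_neighbors hn S x y
  suffices #{u ∈ S | (hierarchicalCubicNetwork n).Adj (x, y) u} ≤ 2 by omega
  rw [h3]
  by_cases hx : x = fun _ => false
  · subst hx
    rw [if_neg, hS, row_outerBoundary_networkSubcube hn]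
    · refine card_neighbors_outerBoundary_subcube_le (fun h' => hp.1 ?_) fun h' => hp.2 ?_
      · exact mem_networkSubcube.2 ⟨rfl, h'⟩
      · rw [← row_outerBoundary_networkSubcube hn] at h'
        exact mem_row.1 h'
    · intro h'
      have := externalNeighbor_mem_of_mem_outerBoundary hn (externalNeighbor_fst_ne hn _) h'
      rw [externalNeighbor_externalNeighbor] at this
      exact hp.1 this
  · have h4 := card_row_outerBoundary_le hn hh hx
    rw [← hS] at h4
    have h5 := card_filter_le (row x S) fun z => (binaryCube n).Adj y z
    split_ifs <;> omega

theorem compl_closedNeighborhood_nonempty (hn : 1 ≤ n) {h : ℕ} (hh : h < n) :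
    (networkSubcube n h ∪
      (hierarchicalCubicNetwork n).outerBoundary (networkSubcube n h))ᶜ.Nonempty := by
  refine ⟨(fun _ => true, fun _ => false), ?_⟩
  rw [mem_compl, mem_union, not_or]
  have h1 := one_ne_zero_vector hn
  refine ⟨fun h' => h1 (mem_networkSubcube.1 h').1, fun h' => ?_⟩
  have := externalNeighbor_mem_of_mem_outerBoundary hn h1 h'
  rw [externalNeighbor_of_ne h1, mem_networkSubcube, mem_subcube] at this
  simpa using this.2 ⟨h, hh⟩ le_rfl

end Subcube

theorem superConnectivity_network (n : ℕ) (hn : 1 ≤ n) (h : ℕ) (hh : h ≤ n - 1) :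
    (hierarchicalCubicNetwork n).superConnectivity h = ((2 ^ h * (n + 1 - h) : ℕ) : ℕ∞) := by
  have hlt : h < n := by omega
  refine le_antisymm ?_ ?_
  · have hcut := isSuperVertexCut_outerBoundary ⟨_, zero_mem_networkSubcube n h⟩
      (compl_closedNeighborhood_nonempty hn hlt) (hasInnerDegree_networkSubcube hn hlt.le)
      (fun v hv => hh.trans (hasInnerDegree_compl_closedNeighborhood hn hlt v hv))
    refine (iInf_le _ ⟨_, hcut⟩).trans (Nat.cast_le.2 ?_)
    exact (card_outerBoundary_le_cutCost _ _).trans (cutCost_networkSubcube_le hn hlt.le)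
  · refine le_iInf fun S => Nat.cast_le.2 ?_
    obtain ⟨A, B, hAB, hA, hB, hdA, hdB, hcost⟩ := S.2.exists_cutCost_le
    exact (le_cutCost_network hn hlt.le hAB hA hB hdA hdB).trans hcost

theorem superEdgeConnectivity_network (n : ℕ) (hn : 1 ≤ n) (h : ℕ) (hh : h ≤ n) :
    (hierarchicalCubicNetwork n).superEdgeConnectivity h = ((2 ^ h * (n + 1 - h) : ℕ) : ℕ∞) := by
  refine le_antisymm ?_ ?_
  · have hY : (networkSubcube n h)ᶜ.Nonempty :=
      ⟨(fun _ => true, fun _ => true), mem_compl.2 fun h' =>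
        one_ne_zero_vector hn (mem_networkSubcube.1 h').1⟩
    have hcut := isSuperEdgeCut_interedges ⟨_, zero_mem_networkSubcube n h⟩ hY
      (hasInnerDegree_networkSubcube hn hh)
      (fun v hv => hh.trans (hasInnerDegree_compl_networkSubcube hn h v hv))
    refine (iInf_le _ ⟨_, hcut⟩).trans (Nat.cast_le.2 ?_)
    exact card_image_le.trans
      ((Nat.le_add_left _ _).trans (cutCost_networkSubcube_le hn hh))
  · refine le_iInf fun F => Nat.cast_le.2 ?_
    obtain ⟨A, B, hAB, hA, hB, hdA, hdB, hcost⟩ := F.2.exists_cutCost_le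
    exact (le_cutCost_network hn hh hAB hA hB hdA hdB).trans hcost

end SimpleGraph

theorem theorem3p2 (n : ℕ) (hn : 1 ≤ n) :
    (∀ h : ℕ, h ≤ n - 1 →
      (SimpleGraph.hierarchicalCubicNetwork n).superConnectivity h =
        ((2 ^ h * (n + 1 - h) : ℕ) : ℕ∞)) ∧
    (∀ h : ℕ, h ≤ n →
      (SimpleGraph.hierarchicalCubicNetwork n).superEdgeConnectivity h =
        ((2 ^ h * (n + 1 - h) : ℕ) : ℕ∞)) := by
  exact ⟨fun h hh => SimpleGraph.superConnectivity_network n hn h hh,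
    fun h hh => SimpleGraph.superEdgeConnectivity_network n hn h hh⟩
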